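/- Let $\Lambda$ be an Artin algebra, that is, an algebra over a commutative Artinian ring $R$ which is finitely generated as an $R$-module. Let $\mathrm{mod}\,\Lambda$ be the category of finitely generated right $\Lambda$-modules, and let $\mathcal{X}\subseteq \mathrm{mod}\,\Lambda$ be a full subcategory which contains all finitely generated projective modules and is contravariantly finite: every $M\in\mathrm{mod}\,\Lambda$ admits a morphism $X\to M$ with $X\in\mathcal{X}$ through which every morphism $Y\to M$ with $Y\in\mathcal{X}$ factors. Let $\mathrm{mod}\,\mathcal{X}$ be the (abelian) category of finitely presented $\mathcal{X}$-modules, i.e. of the additive contravariant functors $F$ from $\mathcal{X}$ to abelian groups which admit an exact sequence $\mathcal{X}(-,X_1)\xrightarrow{(-,d)}\mathcal{X}(-,X_0)\to F\to 0$ with $X_0,X_1\in\mathcal{X}$. Let $\vartheta:\mathrm{mod}\,\mathcal{X}\to\mathrm{mod}\,\Lambda$ be the functor $F\mapsto\mathrm{Coker}(d:X_1\to X_0)$, defined on morphisms by lifting them to presentations. It is exact; applied termwise it induces a triangle functor $\mathbb{D}^b_\vartheta:\mathbb{D}^b(\mathrm{mod}\,\mathcal{X})\to\mathbb{D}^b(\mathrm{mod}\,\Lambda)$.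 Let $\mathbb{D}^b_0(\mathrm{mod}\,\mathcal{X})$ be its kernel and $$\widetilde{\mathbb{D}^b_\vartheta}:\ \mathbb{D}^b(\mathrm{mod}\,\mathcal{X})/\mathbb{D}^b_0(\mathrm{mod}\,\mathcal{X})\longrightarrow\mathbb{D}^b(\mathrm{mod}\,\Lambda)$$ the functor which it induces on the Verdier quotient. Let $\mathbb{K}^b_{\Lambda\text{-}ac}(\mathrm{mod}\,\mathcal{X})$ be the full subcategory of $\mathbb{K}^b(\mathrm{mod}\,\mathcal{X})$ consisting of the complexes $\mathbf{F}$ such that the complex of abelian groups $\mathbf{F}(\Lambda)$ is acyclic, and let $\mathbb{D}^b_\Lambda(\mathrm{mod}\,\mathcal{X}):=\mathbb{K}^b(\mathrm{mod}\,\mathcal{X})/\mathbb{K}^b_{\Lambda\text{-}ac}(\mathrm{mod}\,\mathcal{X})$ be the Verdier quotient. Let $\Psi:\mathbb{D}^b_\Lambda(\mathrm{mod}\,\mathcal{X})\to\mathbb{D}^b(\mathrm{mod}\,\mathcal{X})/\mathbb{D}^b_0(\mathrm{mod}\,\mathcal{X})$ be the functor induced by the identity of $\mathbb{K}^b(\mathrm{mod}\,\mathcal{X})$,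 and let $$\widetilde{\vartheta}:=\widetilde{\mathbb{D}^b_\vartheta}\circ\Psi:\ \mathbb{D}^b_\Lambda(\mathrm{mod}\,\mathcal{X})\longrightarrow\mathbb{D}^b(\mathrm{mod}\,\Lambda),$$ which applies $\vartheta$ termwise to complexes. Then $\widetilde{\vartheta}$ is an equivalence of triangulated categories. In particular, $\widetilde{\mathbb{D}^b_\vartheta}$ is an equivalence of triangulated categories, so that $\mathbb{D}^b(\mathrm{mod}\,\mathcal{X})/\mathbb{D}^b_0(\mathrm{mod}\,\mathcal{X})\simeq\mathbb{D}^b(\mathrm{mod}\,\Lambda)$. -/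

import Mathlib

open CategoryTheory Category Limits Pretriangulated Triangulated Opposite ZeroObject

universe v v' u u'

namespace RelativeAuslander

set_option linter.unusedSectionVars false

section Verdier

variable {C : Type*} [Category* C] [HasZeroObject C] [HasShift C ℤ] [Preadditive C]
  [∀ (n : ℤ), (shiftFunctor C n).Additive] [Pretriangulated C] [IsTriangulated C]
  {E : Type*} [Category* E] [HasZeroObject E] [HasShift E ℤ] [Preadditive E]
  [∀ (n : ℤ), (shiftFunctor E n).Additive] [Pretriangulated E]

/-- The Verdier quotient `C / P` of a triangulated category by a triangulated subcategory `P`: the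
localization of `C` at the morphisms having a cone in `P`. -/
def VerdierQuotient (P : ObjectProperty C) [P.IsTriangulated] := P.trW.Localization

namespace VerdierQuotient

variable (P : ObjectProperty C) [P.IsTriangulated]

instance : Category (VerdierQuotient P) := inferInstanceAs (Category P.trW.Localization)

/-- The quotient functor `C ⥤ C / P` (the identity on objects). -/
def Q : C ⥤ VerdierQuotient P := P.trW.Q

instance : (Q P).IsLocalization P.trW := inferInstanceAs (P.trW.Q.IsLocalization P.trW)

noncomputable instance : HasShift (VerdierQuotient P) ℤ :=
  inferInstanceAs (HasShift P.trW.Localization ℤ)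

noncomputable instance : Preadditive (VerdierQuotient P) :=
  inferInstanceAs (Preadditive P.trW.Localization)

instance : HasZeroObject (VerdierQuotient P) :=
  inferInstanceAs (HasZeroObject P.trW.Localization)

instance (n : ℤ) : (shiftFunctor (VerdierQuotient P) n).Additive :=
  inferInstanceAs (shiftFunctor P.trW.Localization n).Additive

noncomputable instance : Pretriangulated (VerdierQuotient P) :=
  inferInstanceAs (Pretriangulated P.trW.Localization)

instance : IsTriangulated (VerdierQuotient P) :=
  inferInstanceAs (IsTriangulated P.trW.Localization)

noncomputable instance : (Q P).CommShift ℤ := inferInstanceAs (P.trW.Q.CommShift ℤ)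

instance : (Q P).Additive := inferInstanceAs P.trW.Q.Additive

instance : (Q P).IsTriangulated := inferInstanceAs P.trW.Q.IsTriangulated

instance : (Q P).mapArrow.EssSurj := Localization.essSurj_mapArrow (Q P) P.trW

end VerdierQuotient

/-- The kernel of a functor: the objects which it sends to zero. -/
def kernel (F : C ⥤ E) : ObjectProperty C := fun X => IsZero (F.obj X)

instance (F : C ⥤ E) : (kernel F).IsClosedUnderIsomorphisms where
  of_iso e h := IsZero.of_iso h (F.mapIso e.symm)

instance (F : C ⥤ E) [F.CommShift ℤ] [F.IsTriangulated] : (kernel F).IsTriangulated where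
  exists_zero := ⟨0, isZero_zero C, F.map_isZero (isZero_zero C)⟩
  isStableUnderShiftBy n :=
    { le_shift X hX := IsZero.of_iso ((shiftFunctor E n).map_isZero hX)
        ((F.commShiftIso n).app X) }
  toIsTriangulatedClosed₂ := .mk' (fun T hT h₁ h₃ ↦
    Triangle.isZero₂_of_isZero₁₃ _ (F.map_distinguished T hT) h₁ h₃)

lemma trW_isInvertedBy (P : ObjectProperty C) (F : C ⥤ E) [F.CommShift ℤ] [F.IsTriangulated]
    (h : P ≤ kernel F) : P.trW.IsInvertedBy F := by
  rintro X Y f ⟨Z, g, k, hT, hZ⟩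
  exact (Triangle.isZero₃_iff_isIso₁ _ (F.map_distinguished _ hT)).1 (h Z hZ)

lemma isZero_Q_obj (P : ObjectProperty C) [P.IsTriangulated] :
    P ≤ kernel (VerdierQuotient.Q P) := by
  intro X hX
  have : IsIso ((VerdierQuotient.Q P).map (0 : X ⟶ 0)) :=
    Localization.inverts (VerdierQuotient.Q P) P.trW _
      ⟨_, _, _, contractible_distinguished₂ X, P.le_shift (1 : ℤ) _ hX⟩
  exact IsZero.of_iso ((VerdierQuotient.Q P).map_isZero (isZero_zero C))
    (asIso ((VerdierQuotient.Q P).map (0 : X ⟶ 0)))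

/-- The functor `C / P ⥤ E` induced by a triangulated functor `F : C ⥤ E` which kills `P`. -/
noncomputable def verdierLift (P : ObjectProperty C) [P.IsTriangulated] (F : C ⥤ E)
    [F.CommShift ℤ] [F.IsTriangulated] (h : P ≤ kernel F) : VerdierQuotient P ⥤ E :=
  Localization.lift F (trW_isInvertedBy P F h) (VerdierQuotient.Q P)

/-- `verdierLift P F h` restricts to `F` along the quotient functor. -/
noncomputable def verdierLiftFac (P : ObjectProperty C) [P.IsTriangulated] (F : C ⥤ E)
    [F.CommShift ℤ] [F.IsTriangulated] (h : P ≤ kernel F) :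
    VerdierQuotient.Q P ⋙ verdierLift P F h ≅ F :=
  Localization.fac F (trW_isInvertedBy P F h) (VerdierQuotient.Q P)

noncomputable instance (P : ObjectProperty C) [P.IsTriangulated] (F : C ⥤ E)
    [F.CommShift ℤ] [F.IsTriangulated] (h : P ≤ kernel F) :
    Localization.Lifting (VerdierQuotient.Q P) P.trW F (verdierLift P F h) := ⟨verdierLiftFac P F h⟩

noncomputable instance (P : ObjectProperty C) [P.IsTriangulated] (F : C ⥤ E)
    [F.CommShift ℤ] [F.IsTriangulated] (h : P ≤ kernel F) :
    (verdierLift P F h).CommShift ℤ :=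
  Functor.commShiftOfLocalization (VerdierQuotient.Q P) P.trW ℤ F (verdierLift P F h)

instance (P : ObjectProperty C) [P.IsTriangulated] (F : C ⥤ E)
    [F.CommShift ℤ] [F.IsTriangulated] (h : P ≤ kernel F) :
    NatTrans.CommShift (verdierLiftFac P F h).hom ℤ :=
  NatTrans.commShift_iso_hom_of_localization (VerdierQuotient.Q P) P.trW ℤ F (verdierLift P F h)

instance (P : ObjectProperty C) [P.IsTriangulated] (F : C ⥤ E)
    [F.CommShift ℤ] [F.IsTriangulated] (h : P ≤ kernel F) :
    (verdierLift P F h).IsTriangulated :=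
  Functor.isTriangulated_of_precomp_iso (verdierLiftFac P F h)

end Verdier

section BoundedComplexes

variable (A : Type*) [Category* A] [Preadditive A]

/-- The bounded complexes: those which are zero outside of some interval `[a, b]`. -/
def bounded : ObjectProperty (HomotopyCategory A (.up ℤ)) := fun K =>
  ∃ a b : ℤ, ∀ i : ℤ, (i < a ∨ b < i) → IsZero (K.as.X i)

instance : (bounded A).IsStableUnderShift ℤ where
  isStableUnderShiftBy n :=
    { le_shift K := by
        obtain ⟨L : CochainComplex A ℤ, rfl⟩ := K.quotient_obj_surjective
        rintro ⟨a, b, hL⟩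
        refine ⟨a - n, b - n, fun i hi => ?_⟩
        erw [HomotopyCategory.shift_quotient_obj]
        exact hL (i + n) (by omega) }

variable [HasZeroObject A]

instance : (bounded A).ContainsZero where
  exists_zero :=
    ⟨(HomotopyCategory.quotient _ _).obj 0, Functor.map_isZero _ (isZero_zero _),
      0, 0, fun i _ => (HomologicalComplex.eval A (.up ℤ) i).map_isZero (isZero_zero _)⟩

variable [HasBinaryBiproducts A]

instance : (bounded A).IsTriangulatedClosed₃ where
  ext₃' T hT := by
    rintro ⟨a₁, b₁, h₁⟩ ⟨a₂, b₂, h₂⟩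
    obtain ⟨f : T.obj₁.as ⟶ T.obj₂.as, hf⟩ :=
      (HomotopyCategory.quotient _ _).map_surjective T.mor₁
    refine ⟨(HomotopyCategory.quotient _ _).obj (CochainComplex.mappingCone f), ?_,
      ⟨Triangle.π₃.mapIso (isoTriangleOfIso₁₂ T _ hT
        (HomotopyCategory.mappingCone_triangleh_distinguished f)
        (Iso.refl _) (Iso.refl _) ?_)⟩⟩
    · refine ⟨min (a₁ - 1) a₂, max (b₁ - 1) b₂, fun i hi => ?_⟩
      change IsZero ((CochainComplex.mappingCone f).X i)
      rw [CochainComplex.mappingCone.isZero_X_iff]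
      exact ⟨h₁ _ (by omega), h₂ _ (by omega)⟩
    · exact (Category.comp_id T.mor₁).trans (hf.symm.trans (Category.id_comp _).symm)

instance : (bounded A).IsTriangulated where
  toIsTriangulatedClosed₂ := .of_isTriangulatedClosed₃

/-- `K^b(A)`: the homotopy category of bounded complexes over an additive category `A`. -/
abbrev Kb := (bounded A).FullSubcategory

noncomputable instance : HasShift (Kb A) ℤ := inferInstance
instance : Preadditive (Kb A) := inferInstance
instance : HasZeroObject (Kb A) := inferInstance
noncomputable instance : Pretriangulated (Kb A) := inferInstance
instance : IsTriangulated (Kb A) := inferInstance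

variable {A} {B : Type*} [Category* B] [Preadditive B] [HasZeroObject B] [HasBinaryBiproducts B]

/-- The functor `K^b(A) ⥤ K^b(B)` which applies an additive functor `F : A ⥤ B` termwise. -/
def mapKb (F : A ⥤ B) [F.Additive] : Kb A ⥤ Kb B :=
  (bounded B).lift ((bounded A).ι ⋙ F.mapHomotopyCategory (.up ℤ)) (by
    rintro ⟨K, a, b, hK⟩
    exact ⟨a, b, fun i hi => F.map_isZero (hK i hi)⟩)

noncomputable instance (F : A ⥤ B) [F.Additive] : (mapKb F).CommShift ℤ := by
  dsimp only [mapKb]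
  infer_instance

instance (F : A ⥤ B) [F.Additive] : (mapKb F).IsTriangulated := by
  dsimp only [mapKb]
  infer_instance

end BoundedComplexes

section BoundedDerived

variable (A : Type*) [Category* A] [Abelian A]

/-- The acyclic complexes in `K^b(A)`. -/
def Kbac : ObjectProperty (Kb A) :=
  (HomotopyCategory.subcategoryAcyclic A).inverseImage (bounded A).ι

instance : (Kbac A).IsTriangulated := by
  dsimp only [Kbac]
  infer_instance

/-- The bounded derived category `D^b(A) = K^b(A) / K^b_ac(A)` of an abelian category `A`. -/
abbrev Db := VerdierQuotient (Kbac A)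

end BoundedDerived


section FinitelyPresented

variable {C : Type u} [Category.{v} C] [Preadditive C]

/-- An exact sequence `C(-, X₁) ⟶ C(-, X₀) ⟶ F ⟶ 0` of contravariant functors to abelian groups.
By the Yoneda lemma, its first map is given by a morphism `d : X₁ ⟶ X₀`. -/
structure Presentation (F : Cᵒᵖ ⥤ AddCommGrpCat.{v}) where
  X₁ : C
  X₀ : C
  d : X₁ ⟶ X₀
  π : preadditiveYoneda.obj X₀ ⟶ F
  w : preadditiveYoneda.map d ≫ π = 0
  exact : (ShortComplex.mk (preadditiveYoneda.map d) π w).Exact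
  epi : Epi π

variable (C) in
/-- The finitely presented `C`-modules: the additive functors `Cᵒᵖ ⥤ Ab` which admit a presentation
by representable functors. -/
def IsFinitelyPresented : ObjectProperty (Cᵒᵖ ⥤ AddCommGrpCat.{v}) := fun F =>
  F.Additive ∧ Nonempty (Presentation F)

lemma app_exact {S : ShortComplex (Cᵒᵖ ⥤ AddCommGrpCat.{v})} (hS : S.Exact) {Y : Cᵒᵖ}
    (y : S.X₂.obj Y) (hy : S.g.app Y y = 0) : ∃ x : S.X₁.obj Y, S.f.app Y x = y :=
  ((S.map ((evaluation _ _).obj Y)).ab_exact_iff).1 (hS.map _) y hy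

lemma exact_of_app {S : ShortComplex (Cᵒᵖ ⥤ AddCommGrpCat.{v})}
    (h : ∀ (Y : Cᵒᵖ) (y : S.X₂.obj Y), S.g.app Y y = 0 → ∃ x : S.X₁.obj Y, S.f.app Y x = y) :
    S.Exact := by
  rw [ShortComplex.exact_iff_isZero_homology, Functor.isZero_iff]
  intro Y
  refine IsZero.of_iso ?_ (S.mapHomologyIso ((evaluation _ _).obj Y)).symm
  rw [← ShortComplex.exact_iff_isZero_homology, ShortComplex.ab_exact_iff]
  exact h Y

lemma app_surjective {F G : Cᵒᵖ ⥤ AddCommGrpCat.{v}} (f : F ⟶ G) [Epi f] (Y : Cᵒᵖ) :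
    Function.Surjective (f.app Y) :=
  (AddCommGrpCat.epi_iff_surjective _).1 inferInstance

lemma app_injective {F G : Cᵒᵖ ⥤ AddCommGrpCat.{v}} (f : F ⟶ G) [Mono f] (Y : Cᵒᵖ) :
    Function.Injective (f.app Y) :=
  (AddCommGrpCat.mono_iff_injective _).1 inferInstance

lemma app_comp_zero {F G H : Cᵒᵖ ⥤ AddCommGrpCat.{v}} {f : F ⟶ G} {g : G ⟶ H} (w : f ≫ g = 0)
    {Y : Cᵒᵖ} (x : F.obj Y) : g.app Y (f.app Y x) = 0 :=
  ConcreteCategory.congr_hom (NatTrans.congr_app w Y) x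

lemma map_sub_op {F : Cᵒᵖ ⥤ AddCommGrpCat.{v}} (hF : F.Additive) {A B : C} (f g : A ⟶ B)
    (x : F.obj (op B)) : F.map (f - g).op x = F.map f.op x - F.map g.op x := by
  have : F.map (f - g).op = F.map f.op - F.map g.op := F.map_sub
  rw [this]; rfl

lemma map_comp_op (F : Cᵒᵖ ⥤ AddCommGrpCat.{v}) {A B D : C} (f : A ⟶ B) (g : B ⟶ D)
    (x : F.obj (op D)) : F.map (f ≫ g).op x = F.map f.op (F.map g.op x) := by
  simp

lemma app_map {F G : Cᵒᵖ ⥤ AddCommGrpCat.{v}} (φ : F ⟶ G) {A B : C} (f : A ⟶ B)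
    (x : F.obj (op B)) : φ.app (op A) (F.map f.op x) = G.map f.op (φ.app (op B) x) :=
  NatTrans.naturality_apply φ f.op x

namespace Presentation

variable {F : Cᵒᵖ ⥤ AddCommGrpCat.{v}} (p : Presentation F)

/-- The element of `F X₀` which corresponds to `C(-, X₀) ⟶ F`. -/
def gen : F.obj (op p.X₀) :=
  p.π.app (op p.X₀) (𝟙 p.X₀ : p.X₀ ⟶ p.X₀)

lemma π_app {Y : C} (f : Y ⟶ p.X₀) : p.π.app (op Y) f = F.map f.op p.gen := by
  have := app_map p.π f (𝟙 p.X₀ : p.X₀ ⟶ p.X₀)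
  rw [gen, ← this]
  congr 1
  exact (Category.comp_id f).symm

lemma gen_surj {Y : C} (y : F.obj (op Y)) : ∃ f : Y ⟶ p.X₀, F.map f.op p.gen = y := by
  have := p.epi
  obtain ⟨f, hf⟩ := app_surjective p.π (op Y) y
  exact ⟨f, (p.π_app f).symm.trans hf⟩

lemma map_d_gen : F.map p.d.op p.gen = 0 := by
  rw [← π_app]
  have := app_comp_zero p.w (Y := op p.X₁) (𝟙 p.X₁ : p.X₁ ⟶ p.X₁)
  refine Eq.trans ?_ this
  congr 1
  exact (Category.id_comp p.d).symm

lemma exists_fac {Y : C} (f : Y ⟶ p.X₀) (hf : F.map f.op p.gen = 0) :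
    ∃ g : Y ⟶ p.X₁, g ≫ p.d = f :=
  app_exact p.exact (Y := op Y) f ((p.π_app f).trans hf)

/-- The transformation `C(-, X) ⟶ F` given by an element of `F X`. -/
def ofElement (hF : F.Additive) {X : C} (x : F.obj (op X)) : preadditiveYoneda.obj X ⟶ F where
  app Y := AddCommGrpCat.ofHom
    { toFun := fun f : Y.unop ⟶ X => F.map f.op x
      map_zero' := ConcreteCategory.congr_hom (F.map_zero (op X) Y) x
      map_add' := fun f g => ConcreteCategory.congr_hom
        (hF.map_add (f := (f : Y.unop ⟶ X).op) (g := (g : Y.unop ⟶ X).op)) x }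
  naturality Y Z g := by
    ext f
    exact map_comp_op F g.unop f x

lemma exists_of_elements (hF : F.Additive) {X₁ X₀ : C} (d : X₁ ⟶ X₀) (x : F.obj (op X₀))
    (hd : F.map d.op x = 0)
    (hx : ∀ (Y : C) (y : F.obj (op Y)), ∃ f : Y ⟶ X₀, F.map f.op x = y)
    (hfac : ∀ (Y : C) (f : Y ⟶ X₀), F.map f.op x = 0 → ∃ g : Y ⟶ X₁, g ≫ d = f) :
    Nonempty (Presentation F) := by
  refine ⟨⟨X₁, X₀, d, ofElement hF x, ?_, exact_of_app ?_, ?_⟩⟩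
  · ext Y f
    have h (f : Y.unop ⟶ X₁) : F.map (f ≫ d).op x = 0 := by
      rw [map_comp_op, hd, map_zero]
    exact h f
  · intro Y f hf
    exact hfac Y.unop f hf
  · rw [NatTrans.epi_iff_epi_app]
    intro Y
    rw [AddCommGrpCat.epi_iff_surjective]
    intro y
    exact hx Y.unop y

end Presentation

variable (C) in
/-- Weak binary products and weak pullbacks: this suffices for the category of finitely presented
modules to be abelian. -/
class HasWeakFiniteLimits : Prop where
  nonempty : Nonempty C
  prod (A B : C) : ∃ (W : C) (p : W ⟶ A) (q : W ⟶ B), ∀ (Y : C) (f : Y ⟶ A) (g : Y ⟶ B),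
    ∃ h : Y ⟶ W, h ≫ p = f ∧ h ≫ q = g
  pullback {A B D : C} (a : A ⟶ D) (b : B ⟶ D) : ∃ (W : C) (p : W ⟶ A) (q : W ⟶ B),
    p ≫ a = q ≫ b ∧ ∀ (Y : C) (f : Y ⟶ A) (g : Y ⟶ B), f ≫ a = g ≫ b →
      ∃ h : Y ⟶ W, h ≫ p = f ∧ h ≫ q = g

/-- `F` is a quotient of a representable functor. -/
def Generated (F : Cᵒᵖ ⥤ AddCommGrpCat.{v}) : Prop :=
  ∃ (X : C) (x : F.obj (op X)), ∀ (Y : C) (y : F.obj (op Y)), ∃ f : Y ⟶ X, F.map f.op x = y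

/-- The kernel of each map from a representable functor to `F` is a quotient of a representable
functor. -/
def WeaklyCoherent (F : Cᵒᵖ ⥤ AddCommGrpCat.{v}) : Prop :=
  ∀ (A : C) (a : F.obj (op A)), ∃ (B : C) (b : B ⟶ A), F.map b.op a = 0 ∧
    ∀ (Y : C) (f : Y ⟶ A), F.map f.op a = 0 → ∃ g : Y ⟶ B, g ≫ b = f

lemma isFinitelyPresented_iff [HasWeakFiniteLimits C] (F : Cᵒᵖ ⥤ AddCommGrpCat.{v}) :
    IsFinitelyPresented C F ↔ F.Additive ∧ Generated F ∧ WeaklyCoherent F := by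
  constructor
  · rintro ⟨hF, ⟨p⟩⟩
    refine ⟨hF, ⟨p.X₀, p.gen, fun Y y => p.gen_surj y⟩, fun A a => ?_⟩
    obtain ⟨α, rfl⟩ := p.gen_surj a
    obtain ⟨W, q, r, hqr, hW⟩ := HasWeakFiniteLimits.pullback α p.d
    refine ⟨W, q, ?_, fun Y f hf => ?_⟩
    · rw [← map_comp_op, hqr, map_comp_op, p.map_d_gen, map_zero]
    · rw [← map_comp_op] at hf
      obtain ⟨g, hg⟩ := p.exists_fac _ hf
      obtain ⟨h, h₁, -⟩ := hW Y f g hg.symm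
      exact ⟨h, h₁⟩
  · rintro ⟨hF, ⟨X, x, hx⟩, h⟩
    obtain ⟨B, b, hb, hB⟩ := h X x
    exact ⟨hF, Presentation.exists_of_elements hF b x hb hx hB⟩

lemma additive_of_mono {F G : Cᵒᵖ ⥤ AddCommGrpCat.{v}} (i : F ⟶ G) [Mono i] (hG : G.Additive) :
    F.Additive where
  map_add {X Y f g} := by
    ext x
    apply app_injective i
    have h (k : X ⟶ Y) : i.app Y (F.map k x) = G.map k (i.app X x) :=
      NatTrans.naturality_apply i k x
    rw [AddCommGrpCat.hom_add_apply, map_add, h, h, h, hG.map_add]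
    rfl

lemma additive_of_epi {F G : Cᵒᵖ ⥤ AddCommGrpCat.{v}} (q : F ⟶ G) [Epi q] (hF : F.Additive) :
    G.Additive where
  map_add {X Y f g} := by
    ext y
    obtain ⟨x, rfl⟩ := app_surjective q X y
    have h (k : X ⟶ Y) : q.app Y (F.map k x) = G.map k (q.app X x) :=
      NatTrans.naturality_apply q k x
    rw [AddCommGrpCat.hom_add_apply, ← h, ← h, ← h, hF.map_add, ← map_add]
    rfl

variable [HasWeakFiniteLimits C]

instance : (IsFinitelyPresented C).IsClosedUnderIsomorphisms where
  of_iso {F G} e := by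
    rintro ⟨hF, ⟨p⟩⟩
    have hG : G.Additive := additive_of_epi e.hom hF
    have h (Y : C) (y : G.obj (op Y)) : e.hom.app _ (e.inv.app _ y) = y :=
      ConcreteCategory.congr_hom (NatTrans.congr_app e.inv_hom_id (op Y)) y
    refine ⟨hG, Presentation.exists_of_elements hG p.d (e.hom.app _ p.gen) ?_ ?_ ?_⟩
    · rw [← app_map, p.map_d_gen, map_zero]
    · intro Y y
      obtain ⟨f, hf⟩ := p.gen_surj (e.inv.app _ y)
      exact ⟨f, by rw [← app_map, hf, h]⟩
    · intro Y f hf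
      refine p.exists_fac f (app_injective e.hom _ ?_)
      rw [app_map, hf, map_zero]

instance : (IsFinitelyPresented C).ContainsZero where
  exists_zero := by
    refine ⟨0, isZero_zero _, ?_⟩
    have h (Y : Cᵒᵖ) (y : (0 : Cᵒᵖ ⥤ AddCommGrpCat.{v}).obj Y) : y = 0 :=
      (AddCommGrpCat.subsingleton_of_isZero ((Functor.isZero_iff _).1 (isZero_zero _) Y)).elim _ _
    rw [isFinitelyPresented_iff]
    refine ⟨⟨fun {X Y f g} => by ext; exact (h _ _).trans (h _ _).symm⟩, ?_, ?_⟩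
    · obtain ⟨X⟩ := HasWeakFiniteLimits.nonempty (C := C)
      obtain ⟨W, p, -, hW⟩ := HasWeakFiniteLimits.prod X X
      exact ⟨X, 0, fun Y y => ⟨0, (h _ _).trans (h _ _).symm⟩⟩
    · exact fun A a => ⟨A, 𝟙 A, h _ _, fun Y f _ => ⟨f, Category.comp_id f⟩⟩

instance : (IsFinitelyPresented C).IsClosedUnderKernels where
  kernels_le := by
    intro K hK
    obtain ⟨φ, k, hk, hF, hG⟩ := hK
    rename_i F G
    rw [isFinitelyPresented_iff] at hF hG ⊢
    obtain ⟨hF, ⟨X, x, hx⟩, hF'⟩ := hF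
    obtain ⟨hG, -, hG'⟩ := hG
    have : Mono k.ι := Fork.IsLimit.mono hk
    have hex : (ShortComplex.mk k.ι φ k.condition).Exact :=
      ShortComplex.exact_of_f_is_kernel _ (IsLimit.ofIsoLimit hk (Fork.ext (Iso.refl _)))
    refine ⟨additive_of_mono k.ι hF, ?_, fun A a => ?_⟩
    · obtain ⟨B, b, hb, hB⟩ := hG' X (φ.app _ x)
      rw [← app_map] at hb
      obtain ⟨z, hz⟩ := app_exact hex _ hb
      refine ⟨B, z, fun Y y => ?_⟩
      obtain ⟨f, hf⟩ := hx Y (k.ι.app _ y)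
      obtain ⟨g, rfl⟩ := hB Y f (by rw [← app_map, hf]; exact app_comp_zero k.condition y)
      refine ⟨g, app_injective k.ι _ ?_⟩
      rw [← hf, app_map]
      dsimp at hz
      rw [hz, map_comp_op]
    · obtain ⟨B, b, hb, hB⟩ := hF' A (k.ι.app _ a)
      refine ⟨B, b, app_injective k.ι _ ?_, fun Y f hf => hB Y f ?_⟩
      · rw [app_map, hb, map_zero]
      · rw [← app_map, hf, map_zero]

instance : (IsFinitelyPresented C).IsClosedUnderCokernels where
  cokernels_le := by
    intro K hK
    obtain ⟨φ, k, hk, hF, hG⟩ := hK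
    rename_i F G
    rw [isFinitelyPresented_iff] at hF hG ⊢
    obtain ⟨-, ⟨X, x, hx⟩, -⟩ := hF
    obtain ⟨hG, ⟨Z, z, hz⟩, hG'⟩ := hG
    have : Epi k.π := Cofork.IsColimit.epi hk
    have hex : (ShortComplex.mk φ k.π k.condition).Exact :=
      ShortComplex.exact_of_g_is_cokernel _ (IsColimit.ofIsoColimit hk (Cofork.ext (Iso.refl _)))
    refine ⟨additive_of_epi k.π hG, ?_, fun A a => ?_⟩
    · refine ⟨Z, k.π.app _ z, fun Y y => ?_⟩
      obtain ⟨y, rfl⟩ := app_surjective k.π _ y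
      obtain ⟨f, rfl⟩ := hz Y y
      exact ⟨f, (app_map k.π f z).symm⟩
    · obtain ⟨a, rfl⟩ := app_surjective k.π _ a
      obtain ⟨W, p, q, hW⟩ := HasWeakFiniteLimits.prod A X
      obtain ⟨B, b, hb, hB⟩ := hG' W (G.map p.op a - G.map q.op (φ.app _ x))
      refine ⟨B, b ≫ p, ?_, fun Y f hf => ?_⟩
      · rw [map_sub, ← map_comp_op, ← map_comp_op, sub_eq_zero, ← app_map] at hb
        rw [← app_map, hb]
        exact app_comp_zero k.condition _
      · rw [← app_map] at hf
        obtain ⟨y, hy⟩ := app_exact hex _ hf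
        obtain ⟨g, rfl⟩ := hx Y y
        obtain ⟨h, h₁, h₂⟩ := hW Y f g
        obtain ⟨r, hr⟩ := hB Y h (by
          rw [map_sub, ← map_comp_op, ← map_comp_op, h₁, h₂, ← app_map, sub_eq_zero]
          exact hy.symm)
        exact ⟨r, by rw [← Category.assoc, hr, h₁]⟩

lemma isFinitelyPresented_biprod {F G : Cᵒᵖ ⥤ AddCommGrpCat.{v}} (hF : IsFinitelyPresented C F)
    (hG : IsFinitelyPresented C G) : IsFinitelyPresented C (F ⊞ G) := by
  rw [isFinitelyPresented_iff] at hF hG ⊢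
  obtain ⟨hF, ⟨X, x, hx⟩, hF'⟩ := hF
  obtain ⟨hG, ⟨Z, z, hz⟩, hG'⟩ := hG
  have ext' {Y : Cᵒᵖ} {a b : (F ⊞ G).obj Y}
      (h₁ : (biprod.fst : F ⊞ G ⟶ F).app Y a = (biprod.fst : F ⊞ G ⟶ F).app Y b)
      (h₂ : (biprod.snd : F ⊞ G ⟶ G).app Y a = (biprod.snd : F ⊞ G ⟶ G).app Y b) : a = b := by
    have h (c : (F ⊞ G).obj Y) : c = (biprod.inl : F ⟶ F ⊞ G).app Y
        ((biprod.fst : F ⊞ G ⟶ F).app Y c) + (biprod.inr : G ⟶ F ⊞ G).app Y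
        ((biprod.snd : F ⊞ G ⟶ G).app Y c) :=
      (ConcreteCategory.congr_hom (NatTrans.congr_app (biprod.total (X := F) (Y := G)) Y) c).symm
    rw [h a, h b, h₁, h₂]
  have hadd : (F ⊞ G).Additive := ⟨fun {Y Y' f g} => by
    ext a
    have h₁ (k : Y ⟶ Y') : (biprod.fst : F ⊞ G ⟶ F).app Y' ((F ⊞ G).map k a) =
      F.map k ((biprod.fst : F ⊞ G ⟶ F).app Y a) := NatTrans.naturality_apply _ k a
    have h₂ (k : Y ⟶ Y') : (biprod.snd : F ⊞ G ⟶ G).app Y' ((F ⊞ G).map k a) =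
      G.map k ((biprod.snd : F ⊞ G ⟶ G).app Y a) := NatTrans.naturality_apply _ k a
    apply ext'
    · rw [AddCommGrpCat.hom_add_apply, map_add, h₁, h₁, h₁, hF.map_add]; rfl
    · rw [AddCommGrpCat.hom_add_apply, map_add, h₂, h₂, h₂, hG.map_add]; rfl⟩
  refine ⟨hadd, ?_, fun A a => ?_⟩
  · obtain ⟨W, p, q, hW⟩ := HasWeakFiniteLimits.prod X Z
    have e₁ (y) : (biprod.fst : F ⊞ G ⟶ F).app (op W) ((biprod.inl : F ⟶ F ⊞ G).app _ y) = y :=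
      ConcreteCategory.congr_hom (NatTrans.congr_app (biprod.inl_fst (X := F) (Y := G)) _) y
    have e₂ (y) : (biprod.snd : F ⊞ G ⟶ G).app (op W) ((biprod.inl : F ⟶ F ⊞ G).app _ y) = 0 :=
      ConcreteCategory.congr_hom (NatTrans.congr_app (biprod.inl_snd (X := F) (Y := G)) _) y
    have e₃ (y) : (biprod.fst : F ⊞ G ⟶ F).app (op W) ((biprod.inr : G ⟶ F ⊞ G).app _ y) = 0 :=
      ConcreteCategory.congr_hom (NatTrans.congr_app (biprod.inr_fst (X := F) (Y := G)) _) y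
    have e₄ (y) : (biprod.snd : F ⊞ G ⟶ G).app (op W) ((biprod.inr : G ⟶ F ⊞ G).app _ y) = y :=
      ConcreteCategory.congr_hom (NatTrans.congr_app (biprod.inr_snd (X := F) (Y := G)) _) y
    refine ⟨W, (biprod.inl : F ⟶ F ⊞ G).app _ (F.map p.op x) +
      (biprod.inr : G ⟶ F ⊞ G).app _ (G.map q.op z), fun Y y => ?_⟩
    obtain ⟨f, hf⟩ := hx Y ((biprod.fst : F ⊞ G ⟶ F).app _ y)
    obtain ⟨g, hg⟩ := hz Y ((biprod.snd : F ⊞ G ⟶ G).app _ y)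
    obtain ⟨h, rfl, rfl⟩ := hW Y f g
    refine ⟨h, ext' ?_ ?_⟩
    · rw [app_map, map_add, e₁, e₃, add_zero, ← hf, map_comp_op]
    · rw [app_map, map_add, e₂, e₄, zero_add, ← hg, map_comp_op]
  · obtain ⟨B, b, hb, hB⟩ := hF' A ((biprod.fst : F ⊞ G ⟶ F).app _ a)
    obtain ⟨D, d, hd, hD⟩ := hG' B (G.map b.op ((biprod.snd : F ⊞ G ⟶ G).app _ a))
    refine ⟨D, d ≫ b, ext' ?_ ?_, fun Y f hf => ?_⟩
    · rw [app_map, map_comp_op, hb, map_zero, map_zero]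
    · rw [app_map, map_comp_op, hd, map_zero]
    · obtain ⟨g, rfl⟩ := hB Y f (by rw [← app_map, hf, map_zero])
      obtain ⟨h, rfl⟩ := hD Y g (by rw [← map_comp_op, ← app_map, hf, map_zero])
      exact ⟨h, (Category.assoc _ _ _).symm⟩

instance : (IsFinitelyPresented C).IsClosedUnderBinaryProducts where
  limitsOfShape_le := by
    rintro F ⟨p⟩
    refine ObjectProperty.prop_of_iso _ ?_ (isFinitelyPresented_biprod
      (p.prop_diag_obj (.mk .left)) (p.prop_diag_obj (.mk .right)))
    exact IsLimit.conePointUniqueUpToIso (BinaryBiproduct.isLimit _ _)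
      ((IsLimit.postcomposeHomEquiv (diagramIsoPair p.diag) _).2 p.isLimit)

instance : (IsFinitelyPresented C).IsClosedUnderFiniteProducts := .mk'

variable (C) in
/-- `mod C`: the category of finitely presented `C`-modules, a full subcategory of all functors
`Cᵒᵖ ⥤ Ab`. -/
abbrev FPMod := (IsFinitelyPresented C).FullSubcategory

noncomputable instance : Abelian (FPMod C) := inferInstance

end FinitelyPresented

section Approximations

variable {A : Type u} [Category.{v} A]

/-- A right `𝓧`-approximation of `M`: a morphism `X ⟶ M` with `X` in `𝓧` through which every morphism
`Y ⟶ M` with `Y` in `𝓧` factors. -/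
def IsRightApproximation (𝓧 : ObjectProperty A) {X M : A} (φ : X ⟶ M) : Prop :=
  𝓧 X ∧ ∀ ⦃Y : A⦄, 𝓧 Y → ∀ f : Y ⟶ M, ∃ g : Y ⟶ X, g ≫ φ = f

/-- `𝓧` is contravariantly finite: every object has a right `𝓧`-approximation. -/
class ContravariantlyFinite (𝓧 : ObjectProperty A) : Prop where
  exists_approximation (M : A) : ∃ (X : A) (φ : X ⟶ M), IsRightApproximation 𝓧 φ

instance [Preadditive A] [HasFiniteProducts A] [HasPullbacks A] (𝓧 : ObjectProperty A)
    [ContravariantlyFinite 𝓧] : HasWeakFiniteLimits 𝓧.FullSubcategory where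
  nonempty := by
    obtain ⟨X, φ, hX, -⟩ := ContravariantlyFinite.exists_approximation (𝓧 := 𝓧) (⊤_ A)
    exact ⟨⟨X, hX⟩⟩
  prod M N := by
    obtain ⟨X, φ, hX, h⟩ := ContravariantlyFinite.exists_approximation (𝓧 := 𝓧) (M.obj ⨯ N.obj)
    refine ⟨⟨X, hX⟩, 𝓧.homMk (φ ≫ prod.fst), 𝓧.homMk (φ ≫ prod.snd), fun Y f g => ?_⟩
    obtain ⟨k, hk⟩ := h Y.property (prod.lift f.hom g.hom)
    refine ⟨𝓧.homMk k, ?_, ?_⟩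
    · ext
      exact (reassoc_of% hk) prod.fst |>.trans (prod.lift_fst _ _)
    · ext
      exact (reassoc_of% hk) prod.snd |>.trans (prod.lift_snd _ _)
  pullback {M N D} a b := by
    obtain ⟨X, φ, hX, h⟩ :=
      ContravariantlyFinite.exists_approximation (𝓧 := 𝓧) (pullback a.hom b.hom)
    refine ⟨⟨X, hX⟩, 𝓧.homMk (φ ≫ pullback.fst _ _), 𝓧.homMk (φ ≫ pullback.snd _ _), ?_,
      fun Y f g hfg => ?_⟩
    · ext
      simp [pullback.condition]
    · obtain ⟨k, hk⟩ := h Y.property (pullback.lift f.hom g.hom (congrArg (·.hom) hfg))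
      refine ⟨𝓧.homMk k, ?_, ?_⟩
      · ext
        exact (reassoc_of% hk) (pullback.fst _ _) |>.trans (pullback.lift_fst _ _ _)
      · ext
        exact (reassoc_of% hk) (pullback.snd _ _) |>.trans (pullback.lift_snd _ _ _)

end Approximations

section Theta

variable {A : Type u} [Category.{v} A] [Abelian A] (𝓧 : ObjectProperty A)

/-- `mod 𝓧` for a full subcategory `𝓧` of an abelian category. -/
abbrev modCat := FPMod 𝓧.FullSubcategory

variable {𝓧}

/-- A chosen presentation `𝓧(-, X₁) ⟶ 𝓧(-, X₀) ⟶ F ⟶ 0`. -/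
noncomputable def presentation (F : modCat 𝓧) : Presentation F.obj := F.property.2.some

lemma additive_obj (F : modCat 𝓧) : F.obj.Additive := F.property.1

/-- `ϑ(F)` is the cokernel of the morphism `X₁ ⟶ X₀` which presents `F`. -/
noncomputable def thetaObj (F : modCat 𝓧) : A := cokernel (presentation F).d.hom

/-- The projection `X₀ ⟶ ϑ(F)`. -/
noncomputable def thetaπ (F : modCat 𝓧) : (presentation F).X₀.obj ⟶ thetaObj F :=
  cokernel.π (presentation F).d.hom

instance (F : modCat 𝓧) : Epi (thetaπ F) := by
  dsimp only [thetaπ]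
  exact coequalizer.π_epi

lemma d_thetaπ (F : modCat 𝓧) : (presentation F).d.hom ≫ thetaπ F = 0 := cokernel.condition _

lemma thetaπ_exact (F : modCat 𝓧) : (ShortComplex.mk _ _ (d_thetaπ F)).Exact :=
  ShortComplex.exact_cokernel _

lemma exists_lift {F G : modCat 𝓧} (φ : F ⟶ G) :
    ∃ f : (presentation F).X₀ ⟶ (presentation G).X₀,
      G.obj.map f.op (presentation G).gen = φ.hom.app _ (presentation F).gen :=
  (presentation G).gen_surj _

lemma comp_π_eq_zero (F : modCat 𝓧) {Y : 𝓧.FullSubcategory} (f : Y ⟶ (presentation F).X₀)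
    (hf : F.obj.map f.op (presentation F).gen = 0) :
    f.hom ≫ thetaπ F = 0 := by
  obtain ⟨g, rfl⟩ := (presentation F).exists_fac f hf
  change (g.hom ≫ (presentation F).d.hom) ≫ thetaπ F = 0
  rw [Category.assoc, d_thetaπ, comp_zero]

lemma comp_π_eq (F : modCat 𝓧) {Y : 𝓧.FullSubcategory} (f g : Y ⟶ (presentation F).X₀)
    (h : F.obj.map f.op (presentation F).gen = F.obj.map g.op (presentation F).gen) :
    f.hom ≫ thetaπ F = g.hom ≫ thetaπ F := by
  have := comp_π_eq_zero F (f - g) (by rw [map_sub_op (additive_obj F), h, sub_self])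
  rw [← sub_eq_zero, ← Preadditive.sub_comp]
  exact this

/-- `ϑ(φ)` is induced by any lift of `φ` to a morphism between the objects `X₀` of the presentations. -/
noncomputable def thetaMap {F G : modCat 𝓧} (φ : F ⟶ G) : thetaObj F ⟶ thetaObj G :=
  cokernel.desc _ ((exists_lift φ).choose.hom ≫ thetaπ G) (by
    refine (Category.assoc _ _ _).symm.trans
      (comp_π_eq_zero G ((presentation F).d ≫ (exists_lift φ).choose) ?_)
    rw [map_comp_op, (exists_lift φ).choose_spec, ← app_map, (presentation F).map_d_gen, map_zero])

lemma π_thetaMap {F G : modCat 𝓧} (φ : F ⟶ G) (f : (presentation F).X₀ ⟶ (presentation G).X₀)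
    (hf : G.obj.map f.op (presentation G).gen = φ.hom.app _ (presentation F).gen) :
    thetaπ F ≫ thetaMap φ =
      f.hom ≫ thetaπ G := by
  exact (cokernel.π_desc _ _ _).trans
    (comp_π_eq G _ _ ((exists_lift φ).choose_spec.trans hf.symm))

variable (𝓧) in
/-- The functor `ϑ : mod 𝓧 ⥤ A`. -/
noncomputable def theta : modCat 𝓧 ⥤ A where
  obj := thetaObj
  map := thetaMap
  map_id F := by
    rw [← cancel_epi (thetaπ F), π_thetaMap (𝟙 F) (𝟙 _) (by simp), Category.comp_id]
    exact Category.id_comp _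
  map_comp {F G H} φ ψ := by
    obtain ⟨f, hf⟩ := exists_lift φ
    obtain ⟨g, hg⟩ := exists_lift ψ
    rw [← cancel_epi (thetaπ F), π_thetaMap (φ ≫ ψ) (f ≫ g) (by
      rw [map_comp_op, hg, ← app_map, hf]; rfl), ← Category.assoc, π_thetaMap φ f hf,
      Category.assoc, π_thetaMap ψ g hg]
    exact Category.assoc _ _ _

instance : (theta 𝓧).Additive where
  map_add {F G φ ψ} := by
    obtain ⟨f, hf⟩ := exists_lift φ
    obtain ⟨g, hg⟩ := exists_lift ψ
    change thetaMap (φ + ψ) = thetaMap φ + thetaMap ψ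
    rw [← cancel_epi (thetaπ F), π_thetaMap (φ + ψ) (f + g),
      Preadditive.comp_add, π_thetaMap φ f hf, π_thetaMap ψ g hg]
    · exact Preadditive.add_comp _ _ _ _ _ _
    · have : G.obj.map (f + g).op = G.obj.map f.op + G.obj.map g.op := (additive_obj G).map_add
      rw [this, AddCommGrpCat.hom_add_apply, hf, hg]
      rfl

/-- The evaluation functor `F ↦ F(P)`, for `P` in `𝓧`. -/
def evalAt {P : A} (hP : 𝓧 P) : modCat 𝓧 ⥤ AddCommGrpCat.{v} :=
  ObjectProperty.ι _ ⋙ (evaluation _ _).obj (op ⟨P, hP⟩)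

instance {P : A} (hP : 𝓧 P) : (evalAt hP).Additive := by
  dsimp only [evalAt]
  infer_instance

lemma exists_rep {P : A} (hP : 𝓧 P) (F : modCat 𝓧) (y : (evalAt hP).obj F) :
    ∃ f : (⟨P, hP⟩ : 𝓧.FullSubcategory) ⟶ (presentation F).X₀,
      F.obj.map f.op (presentation F).gen = y :=
  (presentation F).gen_surj _

/-- The comparison map `F(P) ⟶ Hom(P, ϑ(F))`. -/
noncomputable def evalToHomFun {P : A} (hP : 𝓧 P) (F : modCat 𝓧) (y : (evalAt hP).obj F) :
    P ⟶ thetaObj F :=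
  (exists_rep hP F y).choose.hom ≫ thetaπ F

lemma evalToHomFun_eq {P : A} (hP : 𝓧 P) (F : modCat 𝓧) (y : (evalAt hP).obj F)
    (f : (⟨P, hP⟩ : 𝓧.FullSubcategory) ⟶ (presentation F).X₀)
    (hf : F.obj.map f.op (presentation F).gen = y) :
    evalToHomFun hP F y = f.hom ≫ thetaπ F :=
  comp_π_eq F _ _ ((exists_rep hP F y).choose_spec.trans hf.symm)

lemma evalToHomFun_add {P : A} (hP : 𝓧 P) (F : modCat 𝓧) (y z : (evalAt hP).obj F) :
    evalToHomFun hP F (y + z) = evalToHomFun hP F y + evalToHomFun hP F z := by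
  obtain ⟨f, hf⟩ := exists_rep hP F y
  obtain ⟨g, hg⟩ := exists_rep hP F z
  rw [evalToHomFun_eq hP F y f hf, evalToHomFun_eq hP F z g hg,
    evalToHomFun_eq hP F (y + z) (f + g)]
  · exact Preadditive.add_comp _ _ _ _ _ _
  · have : F.obj.map (f + g).op = F.obj.map f.op + F.obj.map g.op := (additive_obj F).map_add
    rw [this, AddCommGrpCat.hom_add_apply, hf, hg]
    rfl

lemma evalToHomFun_bijective {P : A} (hP : 𝓧 P) [Projective P] (F : modCat 𝓧) :
    Function.Bijective (evalToHomFun hP F) := by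
  constructor
  · suffices ∀ y, evalToHomFun hP F y = 0 → y = 0 by
      intro y z h
      have e := evalToHomFun_add hP F (y - z) z
      rw [sub_add_cancel, h] at e
      exact sub_eq_zero.1 (this _ (right_eq_add.1 e))
    intro y hy
    obtain ⟨f, rfl⟩ := exists_rep hP F y
    rw [evalToHomFun_eq hP F _ f rfl] at hy
    have hS := thetaπ_exact F
    have hf : f = 𝓧.homMk (hS.liftFromProjective f.hom hy) ≫ (presentation F).d := by
      ext
      exact (hS.liftFromProjective_comp f.hom hy).symm
    have h0 : F.obj.map f.op (presentation F).gen = 0 := by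
      rw [hf, map_comp_op, (presentation F).map_d_gen, map_zero]
    exact h0
  · intro g
    let f : (⟨P, hP⟩ : 𝓧.FullSubcategory) ⟶ (presentation F).X₀ :=
      𝓧.homMk (Projective.factorThru g (thetaπ F))
    refine ⟨F.obj.map f.op (presentation F).gen, ?_⟩
    rw [evalToHomFun_eq hP F _ f rfl]
    exact Projective.factorThru_comp _ _

/-- The comparison map `F(P) ⟶ Hom(P, ϑ(F))`, as a natural transformation. -/
noncomputable def evalToHom {P : A} (hP : 𝓧 P) :
    evalAt hP ⟶ theta 𝓧 ⋙ preadditiveCoyoneda.obj (op P) where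
  app F := AddCommGrpCat.ofHom (AddMonoidHom.mk' (evalToHomFun hP F) (evalToHomFun_add hP F))
  naturality F G φ := by
    ext y
    change evalToHomFun hP G (φ.hom.app _ y) = evalToHomFun hP F y ≫ thetaMap φ
    obtain ⟨f, rfl⟩ := exists_rep hP F y
    obtain ⟨g, hg⟩ := exists_lift φ
    rw [evalToHomFun_eq hP F _ f rfl]
    refine (evalToHomFun_eq hP G _ (f ≫ g) ?_).trans ?_
    · rw [map_comp_op, hg, ← app_map]
    · refine (Category.assoc _ _ _).trans (Eq.trans ?_ (Category.assoc _ _ _).symm)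
      rw [π_thetaMap φ g hg]

instance {P : A} (hP : 𝓧 P) [Projective P] : IsIso (evalToHom hP) := by
  have (F : modCat 𝓧) : IsIso ((evalToHom hP).app F) := by
    rw [ConcreteCategory.isIso_iff_bijective]
    exact evalToHomFun_bijective hP F
  exact NatIso.isIso_of_isIso_app _

end Theta

section Acyclicity

lemma mem_subcategoryAcyclic_iff_exact {A : Type u} [Category.{v} A] [Abelian A]
    (K : HomotopyCategory A (.up ℤ)) :
    HomotopyCategory.subcategoryAcyclic A K ↔ ∀ n : ℤ, (K.as.sc n).Exact :=
  HomotopyCategory.quotient_obj_mem_subcategoryAcyclic_iff_exactAt K.as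

lemma subcategoryAcyclic_map_iff {A : Type u} [Category.{v} A] [Abelian A]
    {B : Type u'} [Category.{v'} B] [Abelian B]
    (F : A ⥤ B) [F.Additive] (K : HomotopyCategory A (.up ℤ)) :
    HomotopyCategory.subcategoryAcyclic B ((F.mapHomotopyCategory _).obj K) ↔
      ∀ n : ℤ, ((K.as.sc n).map F).Exact :=
  mem_subcategoryAcyclic_iff_exact _

variable {A : Type u} [Category.{v} A] [Abelian A] {𝓧 : ObjectProperty A}
  [ContravariantlyFinite 𝓧]

instance : (IsFinitelyPresented 𝓧.FullSubcategory).ι.PreservesHomology where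
  preservesKernels _ _ f := ObjectProperty.preservesKernels_ι _ f
  preservesCokernels _ _ f := ObjectProperty.preservesCokernels_ι _ f

/-- The complexes `F` in `K^b(mod 𝓧)` such that the complex `F(P)` of abelian groups is acyclic. -/
def KbacAt {P : A} (hP : 𝓧 P) : ObjectProperty (Kb (modCat 𝓧)) :=
  (HomotopyCategory.subcategoryAcyclic AddCommGrpCat.{v}).inverseImage
    ((bounded (modCat 𝓧)).ι ⋙ (evalAt hP).mapHomotopyCategory (.up ℤ))

instance {P : A} (hP : 𝓧 P) : (KbacAt hP).IsTriangulated := by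
  dsimp only [KbacAt]
  infer_instance

lemma Kbac_le_KbacAt {P : A} (hP : 𝓧 P) : Kbac (modCat 𝓧) ≤ KbacAt hP := by
  intro K hK
  refine (subcategoryAcyclic_map_iff _ _).2 fun n => ?_
  have h := (mem_subcategoryAcyclic_iff_exact _).1 hK n
  exact (h.map (ObjectProperty.ι _)).map ((evaluation _ _).obj _)

lemma KbacAt_iff {P : A} (hP : 𝓧 P) [Projective P] (hP' : IsSeparator P) (K : Kb (modCat 𝓧)) :
    KbacAt hP K ↔ Kbac A ((mapKb (theta 𝓧)).obj K) := by
  have : (preadditiveCoyoneda.obj (op P)).Faithful :=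
    (isSeparator_iff_faithful_preadditiveCoyoneda P).1 hP'
  have : (preadditiveCoyoneda.obj (op P)).PreservesHomology := by
    have := (Projective.projective_iff_preservesEpimorphisms_preadditiveCoyoneda_obj P).1 inferInstance
    exact Functor.preservesHomology_of_preservesEpis_and_kernels _
  refine (subcategoryAcyclic_map_iff (evalAt hP) K.obj).trans
    (Iff.trans ?_ (subcategoryAcyclic_map_iff (theta 𝓧) K.obj).symm)
  refine forall_congr' fun n => ?_
  rw [ShortComplex.exact_iff_of_iso
    (ShortComplex.mapNatIso (K.obj.as.sc n) (asIso (evalToHom hP))),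
    ← ShortComplex.exact_map_iff_of_faithful _ (preadditiveCoyoneda.obj (op P))]
  rfl

end Acyclicity


section ArtinAlgebra

lemma isNoetherianRing_mulOpposite (R : Type v) (Λ : Type u) [CommRing R] [IsArtinianRing R]
    [Ring Λ] [Algebra R Λ] [Module.Finite R Λ] : IsNoetherianRing Λᵐᵒᵖ := by
  have : IsNoetherian R Λᵐᵒᵖ :=
    isNoetherian_of_linearEquiv (MulOpposite.opLinearEquiv R : Λ ≃ₗ[R] Λᵐᵒᵖ)
  exact isNoetherian_of_tower R this

variable (Λ : Type u) [Ring Λ]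

/-- `Λ` as a right module over itself is free of rank one. -/
def regularEquiv : Λᵐᵒᵖ ≃ₗ[Λᵐᵒᵖ] Λ where
  toFun := MulOpposite.unop
  invFun := MulOpposite.op
  map_add' _ _ := rfl
  map_smul' _ _ := rfl

instance : Module.Finite Λᵐᵒᵖ Λ := Module.Finite.equiv (regularEquiv Λ)

instance : Module.Projective Λᵐᵒᵖ Λ := Module.Projective.of_equiv (regularEquiv Λ)

/-- `mod Λ`: the category of finitely generated right `Λ`-modules, that is, of finitely generated left
`Λᵐᵒᵖ`-modules. -/
abbrev modRight := FGModuleCat.{u} Λᵐᵒᵖ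

/-- The right module `Λ`. -/
abbrev regular : modRight Λ := FGModuleCat.of Λᵐᵒᵖ Λ

/-- The morphism `Λ ⟶ M` sending `1` to `m`. -/
def fromRegular {M : modRight Λ} (m : M) : regular Λ ⟶ M :=
  FGModuleCat.ofHom ((LinearMap.toSpanSingleton Λᵐᵒᵖ M m).comp (regularEquiv Λ).symm.toLinearMap)

lemma fromRegular_one {M : modRight Λ} (m : M) : (fromRegular Λ m).hom.hom (1 : Λ) = m :=
  one_smul Λᵐᵒᵖ m

variable {Λ} in
lemma hom_ext_regular {M : modRight Λ} {f g : regular Λ ⟶ M}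
    (h : f.hom.hom (1 : Λ) = g.hom.hom (1 : Λ)) : f = g := by
  refine FGModuleCat.hom_ext (LinearMap.ext fun x => ?_)
  have hx : (x : Λ) = MulOpposite.op (x : Λ) • (1 : Λ) := (one_mul _).symm
  rw [hx]
  exact (f.hom.hom.map_smul _ _).trans ((congrArg _ h).trans (g.hom.hom.map_smul _ _).symm)

lemma isSeparator_regular : IsSeparator (regular Λ) := by
  rw [isSeparator_def]
  intro M N f g h
  refine FGModuleCat.hom_ext (LinearMap.ext fun m => ?_)
  have e : f.hom.hom ((fromRegular Λ m).hom.hom (1 : Λ)) =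
      g.hom.hom ((fromRegular Λ m).hom.hom (1 : Λ)) :=
    congrArg (fun k : regular Λ ⟶ N => k.hom.hom (1 : Λ)) (h (fromRegular Λ m))
  rwa [fromRegular_one] at e

variable [IsNoetherianRing Λᵐᵒᵖ]

instance : Projective (regular Λ) where
  factors {M N} f e _ := by
    have : Epi ((forget₂ (modRight Λ) (ModuleCat.{u} Λᵐᵒᵖ)).map e) := inferInstance
    obtain ⟨n, hn⟩ := (ModuleCat.epi_iff_surjective _).1 this (f.hom.hom (1 : Λ))
    refine ⟨fromRegular Λ n, hom_ext_regular ?_⟩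
    exact (congrArg e.hom.hom (fromRegular_one Λ n)).trans hn

/-- `𝓧` contains the finitely generated projective right `Λ`-modules. -/
class ContainsProjectives {Λ : Type u} [Ring Λ] (𝓧 : ObjectProperty (modRight Λ)) : Prop where
  of_projective (P : modRight Λ) : Module.Projective Λᵐᵒᵖ P → 𝓧 P

end ArtinAlgebra

section Main

variable {Λ : Type u} [Ring Λ] [IsNoetherianRing Λᵐᵒᵖ] (𝓧 : ObjectProperty (modRight Λ))
  [ContravariantlyFinite 𝓧] [ContainsProjectives 𝓧]

lemma regular_mem : 𝓧 (regular Λ) :=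
  ContainsProjectives.of_projective _ (inferInstanceAs (Module.Projective Λᵐᵒᵖ Λ))

/-- `K^b_{Λ-ac}(mod 𝓧)`: the bounded complexes `F` over `mod 𝓧` such that `F(Λ)` is acyclic. -/
abbrev KbLambdaAc : ObjectProperty (Kb (modCat 𝓧)) := KbacAt (regular_mem 𝓧)

/-- `D^b_Λ(mod 𝓧) = K^b(mod 𝓧) / K^b_{Λ-ac}(mod 𝓧)`. -/
abbrev DbLambda := VerdierQuotient (KbLambdaAc 𝓧)

lemma KbLambdaAc_iff (K : Kb (modCat 𝓧)) :
    KbLambdaAc 𝓧 K ↔ Kbac (modRight Λ) ((mapKb (theta 𝓧)).obj K) :=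
  KbacAt_iff (regular_mem 𝓧) (isSeparator_regular Λ) K

lemma KbLambdaAc_le_kernel :
    KbLambdaAc 𝓧 ≤ kernel (mapKb (theta 𝓧) ⋙ VerdierQuotient.Q (Kbac (modRight Λ))) :=
  fun K hK => isZero_Q_obj _ _ ((KbLambdaAc_iff 𝓧 K).1 hK)

/-- `D^b_ϑ : D^b(mod 𝓧) ⥤ D^b(mod Λ)`, which applies `ϑ` termwise. -/
noncomputable def DbTheta : Db (modCat 𝓧) ⥤ Db (modRight Λ) :=
  verdierLift (Kbac (modCat 𝓧)) (mapKb (theta 𝓧) ⋙ VerdierQuotient.Q (Kbac (modRight Λ)))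
    ((Kbac_le_KbacAt (regular_mem 𝓧)).trans (KbLambdaAc_le_kernel 𝓧))

/-- `DbTheta` applies `ϑ` termwise. -/
noncomputable def DbThetaFac : VerdierQuotient.Q (Kbac (modCat 𝓧)) ⋙ DbTheta 𝓧 ≅
    mapKb (theta 𝓧) ⋙ VerdierQuotient.Q (Kbac (modRight Λ)) :=
  verdierLiftFac _ _ _

noncomputable instance : (DbTheta 𝓧).CommShift ℤ := by
  dsimp only [DbTheta]
  infer_instance

instance : (DbTheta 𝓧).IsTriangulated := by
  dsimp only [DbTheta]
  infer_instance

/-- `D^b_0(mod 𝓧)`: the kernel of `D^b_ϑ`. -/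
abbrev Db₀ : ObjectProperty (Db (modCat 𝓧)) := kernel (DbTheta 𝓧)

/-- The functor `D^b(mod 𝓧) / D^b_0(mod 𝓧) ⥤ D^b(mod Λ)` induced by `D^b_ϑ`. -/
noncomputable def DbThetaTilde : VerdierQuotient (Db₀ 𝓧) ⥤ Db (modRight Λ) :=
  verdierLift (Db₀ 𝓧) (DbTheta 𝓧) le_rfl

/-- `DbThetaTilde` restricts to `DbTheta` along the quotient functor. -/
noncomputable def DbThetaTildeFac : VerdierQuotient.Q (Db₀ 𝓧) ⋙ DbThetaTilde 𝓧 ≅ DbTheta 𝓧 :=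
  verdierLiftFac _ _ _

noncomputable instance : (DbThetaTilde 𝓧).CommShift ℤ := by
  dsimp only [DbThetaTilde]
  infer_instance

instance : (DbThetaTilde 𝓧).IsTriangulated := by
  dsimp only [DbThetaTilde]
  infer_instance

lemma KbLambdaAc_le_kernel_Q : KbLambdaAc 𝓧 ≤
    kernel (VerdierQuotient.Q (Kbac (modCat 𝓧)) ⋙ VerdierQuotient.Q (Db₀ 𝓧)) :=
  fun K hK => isZero_Q_obj (Db₀ 𝓧) _
    (IsZero.of_iso (KbLambdaAc_le_kernel 𝓧 K hK) ((DbThetaFac 𝓧).app K))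

/-- The canonical functor `D^b_Λ(mod 𝓧) ⥤ D^b(mod 𝓧) / D^b_0(mod 𝓧)`, induced by the identity of
`K^b(mod 𝓧)`. -/
noncomputable def Psi : DbLambda 𝓧 ⥤ VerdierQuotient (Db₀ 𝓧) :=
  verdierLift (KbLambdaAc 𝓧)
    (VerdierQuotient.Q (Kbac (modCat 𝓧)) ⋙ VerdierQuotient.Q (Db₀ 𝓧)) (KbLambdaAc_le_kernel_Q 𝓧)

/-- `Psi` is induced by the identity of `K^b(mod 𝓧)`. -/
noncomputable def PsiFac : VerdierQuotient.Q (KbLambdaAc 𝓧) ⋙ Psi 𝓧 ≅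
    VerdierQuotient.Q (Kbac (modCat 𝓧)) ⋙ VerdierQuotient.Q (Db₀ 𝓧) :=
  verdierLiftFac _ _ _

noncomputable instance : (Psi 𝓧).CommShift ℤ := by
  dsimp only [Psi]
  infer_instance

instance : (Psi 𝓧).IsTriangulated := by
  dsimp only [Psi]
  infer_instance

/-- `ϑ̃ : D^b_Λ(mod 𝓧) ⥤ D^b(mod Λ)`. -/
noncomputable def thetaTilde : DbLambda 𝓧 ⥤ Db (modRight Λ) := Psi 𝓧 ⋙ DbThetaTilde 𝓧

noncomputable instance : (thetaTilde 𝓧).CommShift ℤ := by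
  dsimp only [thetaTilde]
  infer_instance

instance : (thetaTilde 𝓧).IsTriangulated := by
  dsimp only [thetaTilde]
  infer_instance

/-- `thetaTilde` acts on complexes termwise by `theta`. -/
noncomputable def thetaTildeFac : VerdierQuotient.Q (KbLambdaAc 𝓧) ⋙ thetaTilde 𝓧 ≅
    mapKb (theta 𝓧) ⋙ VerdierQuotient.Q (Kbac (modRight Λ)) :=
  Functor.isoWhiskerRight (PsiFac 𝓧) (DbThetaTilde 𝓧) ≪≫
    Functor.isoWhiskerLeft (VerdierQuotient.Q (Kbac (modCat 𝓧))) (DbThetaTildeFac 𝓧) ≪≫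
    DbThetaFac 𝓧

end Main

end RelativeAuslander

/-! The functor `ϑ` has a right adjoint, the restricted Yoneda functor `M ↦ Hom(-, M)|𝓧`.
Contravariant finiteness makes these functors finitely presented. Because `𝓧` contains `Λ`, a
projective separator, the counit `ϑ(Hom(-, M)) ⟶ M` is invertible (`isIso_thetaCounit`), so the
right adjoint is fully faithful. Both properties survive termwise on `K^b`, hence `mapKb (theta 𝓧)`
is already a localization of `K^b(mod 𝓧)`, and following it by the quotient functor to `D^b(mod Λ)`
again gives one (`isLocalization_mapKb_theta`).

The class inverted is the right one: naturally `F(Λ) ≅ Hom(Λ, ϑ(F))`, and `Hom(Λ, -)` preserves and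
reflects exactness, so the morphisms sent by `ϑ` to quasi-isomorphisms are those with a cone in
`K^b_{Λ-ac}` (`KbLambdaAc_trW`). Thus `D^b_Λ(mod 𝓧)` and `D^b(mod Λ)` localize the same category at
the same class, and `ϑ̃` is the comparison between them.

For the other functor, `D^b(mod 𝓧)` is an intermediate localization, so `D^b_ϑ` is itself a
localization functor, and the class can be taken to be all morphisms with a cone in its kernel
(`isLocalization_DbTheta`). -/

namespace RelativeAuslander

/-! ### Localization functors: composites, comparison, enlarging the class. -/

section Localization

variable {C D E : Type*} [Category* C] [Category* D] [Category* E]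

/-- If `L` has a fully faithful right adjoint, and `Q` is a localization functor for `W`, then
`L ⋙ Q` is a localization functor for the inverse image of `W`. -/
lemma isLocalization_comp_of_adjunction {L : C ⥤ D} {R : D ⥤ C} (adj : L ⊣ R) [R.Full]
    [R.Faithful] (Q : D ⥤ E) (W : MorphismProperty D) [W.IsMultiplicative] [W.RespectsIso]
    [Q.IsLocalization W] : (L ⋙ Q).IsLocalization (W.inverseImage L) := by
  have : L.IsLocalization ((MorphismProperty.isomorphisms D).inverseImage L) :=
    adj.isLocalization
  refine Functor.IsLocalization.comp L Q ((MorphismProperty.isomorphisms D).inverseImage L) W _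
    (fun X Y f hf => Localization.inverts Q W _ hf) (fun X Y f hf => ?_) (fun X Y f hf => ?_)
  · have : IsIso (L.map f) := hf
    exact MorphismProperty.of_isIso W (L.map f)
  -- The counit is invertible because `R` is fully faithful, so every `f` in `W` is isomorphic to
  -- the image under `L` of `R.map f`, which lies in the inverse image class.
  · let e : Arrow.mk (L.map (R.map f)) ≅ Arrow.mk f :=
      Arrow.isoMk (asIso (adj.counit.app X)) (asIso (adj.counit.app Y))
        (adj.counit.naturality f).symm
    refine ((W.inverseImage L).map L).arrow_mk_iso_iff e |>.1 ?_
    exact MorphismProperty.map_mem_map _ _ _ ((W.arrow_mk_iso_iff e).2 hf)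

/-- A functor between two localizations of a category at the same class is an equivalence. -/
lemma isEquivalence_of_isLocalization_comp (L : C ⥤ D) (W : MorphismProperty C)
    [L.IsLocalization W] (G : D ⥤ E) [(L ⋙ G).IsLocalization W] : G.IsEquivalence :=
  -- `G` and the equivalence given by uniqueness of localizations agree after precomposition with
  -- `L`, hence agree.
  Functor.isEquivalence_of_iso (Localization.liftNatIso L W
    (L ⋙ (Localization.uniq L (L ⋙ G) W).functor) (L ⋙ G)
    (Localization.uniq L (L ⋙ G) W).functor G
    (Localization.compUniqFunctor L (L ⋙ G) W))

/-- A localization functor for `W` is one for every larger class which it inverts. -/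
lemma isLocalization_of_le (L : C ⥤ D) (W W' : MorphismProperty C) [L.IsLocalization W]
    (h : W ≤ W') (h' : W'.IsInvertedBy L) : L.IsLocalization W' := by
  -- The identity localizes at the empty class. Composing `L` with it leaves `L` unchanged up to
  -- isomorphism, while the composition criterion allows any class between `W` and what `L` inverts.
  have : (𝟭 D).IsLocalization (⊥ : MorphismProperty D) := Functor.IsLocalization.for_id _ bot_le
  have : (L ⋙ 𝟭 D).IsLocalization W' :=
    Functor.IsLocalization.comp L (𝟭 D) W ⊥ W' h' h bot_le
  exact Functor.IsLocalization.of_iso W' L.rightUnitor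

end Localization

/-! ### Passing an adjunction to bounded homotopy categories. -/

section HomotopyCategory

variable {A B : Type*} [Category* A] [Preadditive A] [Category* B] [Preadditive B]
  {F : A ⥤ B} {G : B ⥤ A} [F.Additive] [G.Additive]

/-- The adjunction on homotopy categories induced by an adjunction of additive functors. -/
noncomputable def mapHomotopyCategoryAdjunction (adj : F ⊣ G) :
    F.mapHomotopyCategory (.up ℤ) ⊣ G.mapHomotopyCategory (.up ℤ) where
  -- Unit and counit are applied degreewise. Naturality and the triangle identities hold for chain
  -- maps, before any homotopy is needed.
  unit :=
    { app K := (HomotopyCategory.quotient _ _).map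
        { f i := adj.unit.app (K.as.X i)
          comm' i j _ := (adj.unit.naturality (K.as.d i j)).symm }
      naturality := by
        rintro ⟨K⟩ ⟨L⟩ ⟨f⟩
        refine congrArg (HomotopyCategory.quotient _ _).map (HomologicalComplex.hom_ext _ _ fun i => ?_)
        exact adj.unit.naturality (f.f i) }
  counit :=
    { app K := (HomotopyCategory.quotient _ _).map
        { f i := adj.counit.app (K.as.X i)
          comm' i j _ := (adj.counit.naturality (K.as.d i j)).symm }
      naturality := by
        rintro ⟨K⟩ ⟨L⟩ ⟨f⟩
        refine congrArg (HomotopyCategory.quotient _ _).map (HomologicalComplex.hom_ext _ _ fun i => ?_)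
        exact adj.counit.naturality (f.f i) }
  left_triangle_components := by
    rintro ⟨K⟩
    refine congrArg (HomotopyCategory.quotient _ _).map (HomologicalComplex.hom_ext _ _ fun i => ?_)
    exact adj.left_triangle_components _
  right_triangle_components := by
    rintro ⟨K⟩
    refine congrArg (HomotopyCategory.quotient _ _).map (HomologicalComplex.hom_ext _ _ fun i => ?_)
    exact adj.right_triangle_components _

variable [HasZeroObject A] [HasZeroObject B] [HasBinaryBiproducts A] [HasBinaryBiproducts B]

/-- The adjunction on bounded homotopy categories induced by an adjunction of additive functors. -/
noncomputable def mapKbAdjunction (adj : F ⊣ G) : mapKb F ⊣ mapKb G :=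
  (mapHomotopyCategoryAdjunction adj).restrictFullyFaithful
    (bounded A).fullyFaithfulι (bounded B).fullyFaithfulι (Iso.refl _) (Iso.refl _)

/-- A fully faithful functor lifts chain maps and also null-homotopies, so it remains fully faithful
modulo homotopy; the bounded complexes form full subcategories. -/
instance (F : A ⥤ B) [F.Additive] [F.Full] [F.Faithful] : (mapKb F).Full := by
  dsimp only [mapKb]
  infer_instance

instance (F : A ⥤ B) [F.Additive] [F.Full] [F.Faithful] : (mapKb F).Faithful := by
  dsimp only [mapKb]
  infer_instance

end HomotopyCategory

/-! ### The restricted Yoneda functor as a fully faithful right adjoint of `ϑ`. -/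

section Restriction

variable {A : Type u} [Category.{v} A] [Abelian A] {𝓧 : ObjectProperty A}

instance (M : A) : (𝓧.ι.op ⋙ preadditiveYoneda.obj M).Additive where
  map_add {_ _ f g} := by
    ext h
    exact Preadditive.add_comp _ _ _ f.unop.hom g.unop.hom h

variable [ContravariantlyFinite 𝓧]

/-- Contravariant finiteness is used twice: an approximation `φ : X ⟶ M` generates `Hom(-, M)` on
`𝓧`, and an approximation of the kernel of `φ` generates the relations. The generating element is
`φ` itself. -/
lemma isFinitelyPresented_restrict (M : A) :
    IsFinitelyPresented 𝓧.FullSubcategory (𝓧.ι.op ⋙ preadditiveYoneda.obj M) := by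
  obtain ⟨X, φ, hX, hφ⟩ := ContravariantlyFinite.exists_approximation (𝓧 := 𝓧) M
  obtain ⟨X', ψ, hX', hψ⟩ := ContravariantlyFinite.exists_approximation (𝓧 := 𝓧) (Limits.kernel φ)
  refine ⟨inferInstance, Presentation.exists_of_elements inferInstance
    (X₁ := ⟨X', hX'⟩) (X₀ := ⟨X, hX⟩) (𝓧.homMk (ψ ≫ Limits.kernel.ι φ)) φ ?_ ?_ ?_⟩
  · change (ψ ≫ Limits.kernel.ι φ) ≫ φ = 0
    simp
  · intro Y y
    obtain ⟨g, hg⟩ := hφ Y.property y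
    exact ⟨𝓧.homMk g, hg⟩
  · intro Y f hf
    obtain ⟨g, hg⟩ := hψ Y.property (Limits.kernel.lift φ f.hom hf)
    refine ⟨𝓧.homMk g, ?_⟩
    ext
    change g ≫ ψ ≫ Limits.kernel.ι φ = f.hom
    rw [reassoc_of% hg]
    exact Limits.kernel.lift_ι φ f.hom hf

variable (𝓧) in
/-- The functor `A ⥤ mod 𝓧` sending `M` to the restriction of `Hom(-, M)` to `𝓧`. -/
def restrictedYoneda : A ⥤ modCat 𝓧 :=
  (IsFinitelyPresented 𝓧.FullSubcategory).lift
    (preadditiveYoneda ⋙ (Functor.whiskeringLeft _ _ _).obj 𝓧.ι.op) isFinitelyPresented_restrict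

instance : (restrictedYoneda 𝓧).Additive where
  map_add {M N f g} := by
    ext Y h
    exact Preadditive.comp_add _ _ _ h f g

/-- The comparison maps `F(Y) ⟶ Hom(Y, ϑ(F))`, for `Y` in `𝓧`. -/
noncomputable def thetaUnit (F : modCat 𝓧) : F ⟶ (restrictedYoneda 𝓧).obj (thetaObj F) :=
  ObjectProperty.homMk
    { app Y := (evalToHom Y.unop.property).app F
      naturality Y Z k := by
        ext y
        obtain ⟨f, rfl⟩ := exists_rep Y.unop.property F y
        change evalToHomFun Z.unop.property F (F.obj.map k.unop.op _) =
          k.unop.hom ≫ evalToHomFun Y.unop.property F _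
        rw [evalToHomFun_eq _ F _ f rfl]
        refine (evalToHomFun_eq _ F _ (k.unop ≫ f) ?_).trans (Category.assoc _ _ _)
        exact map_comp_op _ _ _ _ }

/-- The generator of the presentation of `Hom(-, M)`, as a morphism to `M`. -/
noncomputable def restrictedGen (M : A) :
    (presentation ((restrictedYoneda 𝓧).obj M)).X₀.obj ⟶ M :=
  (presentation ((restrictedYoneda 𝓧).obj M)).gen

variable (𝓧) in
/-- The morphism `ϑ(Hom(-, M)) ⟶ M` induced by the generator of the presentation. -/
noncomputable def thetaCounit (M : A) : thetaObj ((restrictedYoneda 𝓧).obj M) ⟶ M :=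
  -- In `Hom(-, M)` the action of `d` is precomposition, so the relation satisfied by the generator
  -- says precisely that `d` followed by it vanishes.
  cokernel.desc _ (restrictedGen M) (presentation ((restrictedYoneda 𝓧).obj M)).map_d_gen

lemma thetaπ_thetaCounit (M : A) :
    thetaπ ((restrictedYoneda 𝓧).obj M) ≫ thetaCounit 𝓧 M = restrictedGen M :=
  cokernel.π_desc _ _ _

variable (𝓧) in
/-- `ϑ` is left adjoint to the restricted Yoneda functor. -/
noncomputable def thetaAdjunction : theta 𝓧 ⊣ restrictedYoneda 𝓧 where
  unit :=
    { app := thetaUnit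
      naturality F G φ := by
        -- Evaluated at a fixed `Y`, this is naturality in `F` of the comparison `F(Y) ⟶ Hom(Y,
        -- ϑ(F))`.
        ext Y y
        exact ConcreteCategory.congr_hom ((evalToHom Y.unop.property).naturality φ) y }
  counit :=
    { app := thetaCounit 𝓧
      naturality M N g := by
        obtain ⟨f, hf⟩ := exists_lift ((restrictedYoneda 𝓧).map g)
        -- The defining property of a lift, unfolded for Hom functors.
        have hf' : f.hom ≫ restrictedGen N = restrictedGen M ≫ g := hf
        change thetaMap _ ≫ _ = _ ≫ g
        rw [← cancel_epi (thetaπ _), ← Category.assoc, π_thetaMap _ f hf, Category.assoc,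
          thetaπ_thetaCounit, hf', ← Category.assoc, thetaπ_thetaCounit] }
  left_triangle_components F := by
    obtain ⟨f, hf⟩ := exists_lift (thetaUnit F)
    -- The unit sends the generator of `F` to the projection `X₀ ⟶ ϑ(F)`, since the generator is
    -- represented by the identity of `X₀`.
    have hf' : f.hom ≫ restrictedGen (thetaObj F) = thetaπ F := by
      refine hf.trans ((evalToHomFun_eq _ F _ (𝟙 _) (by simp)).trans (Category.id_comp _))
    change thetaMap (thetaUnit F) ≫ thetaCounit 𝓧 (thetaObj F) = 𝟙 (thetaObj F)
    rw [← cancel_epi (thetaπ F), ← Category.assoc, π_thetaMap _ f hf, Category.assoc,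
      thetaπ_thetaCounit, hf', Category.comp_id]
  right_triangle_components M := by
    ext Y y
    obtain ⟨f, rfl⟩ := exists_rep Y.unop.property ((restrictedYoneda 𝓧).obj M) y
    change evalToHomFun _ _ _ ≫ thetaCounit 𝓧 M = f.hom ≫ restrictedGen M
    rw [evalToHomFun_eq _ _ _ f rfl, Category.assoc, thetaπ_thetaCounit]

/-- Mono and epi are tested on maps from the separator `P`. Projectivity lifts any `P ⟶ ϑ(Hom(-,
M))` to `X₀`; if its image in `M` is zero, the lift factors through `d` and dies in the cokernel.
Since `P` is in `𝓧`, every `P ⟶ M` factors through the generator, hence through the counit. -/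
lemma isIso_thetaCounit {P : A} (hP : 𝓧 P) [Projective P] (hP' : IsSeparator P) (M : A) :
    IsIso (thetaCounit 𝓧 M) := by
  have hgen (y : P ⟶ M) : ∃ f : (⟨P, hP⟩ : 𝓧.FullSubcategory) ⟶
      (presentation ((restrictedYoneda 𝓧).obj M)).X₀, f.hom ≫ restrictedGen M = y :=
    exists_rep hP ((restrictedYoneda 𝓧).obj M) y
  rw [isSeparator_def] at hP'
  have : Mono (thetaCounit 𝓧 M) := by
    refine Preadditive.mono_of_cancel_zero _ fun {Z} g hg => hP' _ _ fun h => ?_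
    -- Projectivity of `P` enters here, through surjectivity of the comparison map.
    obtain ⟨y, hy⟩ := (evalToHomFun_bijective hP _).2 (h ≫ g)
    obtain ⟨f, rfl⟩ := exists_rep hP _ y
    -- That is, `f` represents the zero element of `Hom(P, M)`, which is the hypothesis of
    -- `comp_π_eq_zero`.
    have h0 : f.hom ≫ restrictedGen M = 0 := by
      rw [← thetaπ_thetaCounit, ← Category.assoc, ← evalToHomFun_eq hP _ _ f rfl, hy,
        Category.assoc, hg, comp_zero]
    rw [← hy, comp_zero, evalToHomFun_eq hP _ _ f rfl]
    exact comp_π_eq_zero _ f h0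
  have : Epi (thetaCounit 𝓧 M) := by
    refine Preadditive.epi_of_cancel_zero _ fun {Z} g hg => hP' _ _ fun h => ?_
    obtain ⟨f, rfl⟩ := hgen h
    rw [Category.assoc, ← thetaπ_thetaCounit, Category.assoc, hg, comp_zero, comp_zero, comp_zero]
  exact isIso_of_mono_of_epi _

/-- A right adjoint whose counit is invertible is fully faithful. -/
lemma restrictedYoneda_fullyFaithful {P : A} (hP : 𝓧 P) [Projective P] (hP' : IsSeparator P) :
    (restrictedYoneda 𝓧).Full ∧ (restrictedYoneda 𝓧).Faithful := by
  have (M : A) : IsIso ((thetaAdjunction 𝓧).counit.app M) := isIso_thetaCounit hP hP' M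
  have : IsIso (thetaAdjunction 𝓧).counit := NatIso.isIso_of_isIso_app _
  exact ⟨(thetaAdjunction 𝓧).fullyFaithfulROfIsIsoCounit.full,
    (thetaAdjunction 𝓧).fullyFaithfulROfIsIsoCounit.faithful⟩

end Restriction

/-! ### Identifying the localized classes, and the two equivalences. -/

section Equivalences

variable {Λ : Type u} [Ring Λ] [IsNoetherianRing Λᵐᵒᵖ] (𝓧 : ObjectProperty (modRight Λ))
  [ContravariantlyFinite 𝓧] [ContainsProjectives 𝓧]

/-- On objects this is `KbLambdaAc_iff`. It passes to morphisms because `mapKb (theta 𝓧)` is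
triangulated and so carries cones to cones. -/
lemma KbLambdaAc_trW :
    (KbLambdaAc 𝓧).trW = (Kbac (modRight Λ)).trW.inverseImage (mapKb (theta 𝓧)) := by
  have h : KbLambdaAc 𝓧 = (Kbac (modRight Λ)).inverseImage (mapKb (theta 𝓧)) := by
    ext K
    exact KbLambdaAc_iff 𝓧 K
  ext X Y f
  have : (Kbac (modRight Λ)).IsClosedUnderIsomorphisms := by
    dsimp only [Kbac]
    infer_instance
  rw [h]
  exact ObjectProperty.inverseImage_trW_iff _ _ f

/-- The heart of the proof: the adjunction on `K^b` has a fully faithful right adjoint, so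
`isLocalization_comp_of_adjunction` applies to the class of quasi-isomorphisms. -/
instance isLocalization_mapKb_theta :
    (mapKb (theta 𝓧) ⋙ VerdierQuotient.Q (Kbac (modRight Λ))).IsLocalization
      (KbLambdaAc 𝓧).trW := by
  obtain ⟨_, _⟩ := restrictedYoneda_fullyFaithful (regular_mem 𝓧) (isSeparator_regular Λ)
  rw [KbLambdaAc_trW]
  exact isLocalization_comp_of_adjunction (mapKbAdjunction (thetaAdjunction 𝓧)) _ _

instance isEquivalence_thetaTilde : (thetaTilde 𝓧).IsEquivalence := by
  have : (VerdierQuotient.Q (KbLambdaAc 𝓧) ⋙ thetaTilde 𝓧).IsLocalization (KbLambdaAc 𝓧).trW :=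
    Functor.IsLocalization.of_iso _ (thetaTildeFac 𝓧).symm
  exact isEquivalence_of_isLocalization_comp (VerdierQuotient.Q (KbLambdaAc 𝓧))
    (KbLambdaAc 𝓧).trW _

/-- Acyclic complexes are `Λ`-acyclic, so localizing `K^b(mod 𝓧)` at `(KbLambdaAc 𝓧).trW` can be
done in two stages, the first being `D^b(mod 𝓧)`. The second stage is `D^b_ϑ`, which localizes at
the image of that class. -/
instance isLocalization_DbTheta : (DbTheta 𝓧).IsLocalization (Db₀ 𝓧).trW := by
  have : (VerdierQuotient.Q (Kbac (modCat 𝓧)) ⋙ DbTheta 𝓧).IsLocalization (KbLambdaAc 𝓧).trW :=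
    Functor.IsLocalization.of_iso _ (DbThetaFac 𝓧).symm
  have : (DbTheta 𝓧).IsLocalization
      ((KbLambdaAc 𝓧).trW.map (VerdierQuotient.Q (Kbac (modCat 𝓧)))) :=
    Functor.IsLocalization.of_comp (VerdierQuotient.Q (Kbac (modCat 𝓧))) _
      (Kbac (modCat 𝓧)).trW _ (KbLambdaAc 𝓧).trW
      (ObjectProperty.trW_monotone (Kbac_le_KbacAt (regular_mem 𝓧))) rfl
  -- It suffices to place the image class inside `(Db₀ 𝓧).trW`, which `D^b_ϑ` inverts; the two
  -- classes need not be shown equal.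
  refine isLocalization_of_le _ ((KbLambdaAc 𝓧).trW.map (VerdierQuotient.Q (Kbac (modCat 𝓧)))) _
    ?_ (trW_isInvertedBy (Db₀ 𝓧) (DbTheta 𝓧) le_rfl)
  rw [MorphismProperty.map_le_iff]
  intro X Y f hf
  obtain ⟨Z, g, h, hT, hZ⟩ := hf
  -- The quotient functor preserves the triangle, and `D^b_ϑ` kills its `Λ`-acyclic third term.
  exact ObjectProperty.trW.mk _ ((VerdierQuotient.Q (Kbac (modCat 𝓧))).map_distinguished _ hT)
    (IsZero.of_iso (KbLambdaAc_le_kernel 𝓧 Z hZ) ((DbThetaFac 𝓧).app Z))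

/-- Obtained by comparing localizations of `D^b(mod 𝓧)`, without first showing that `Psi` is an
equivalence. -/
instance isEquivalence_DbThetaTilde : (DbThetaTilde 𝓧).IsEquivalence := by
  have : (VerdierQuotient.Q (Db₀ 𝓧) ⋙ DbThetaTilde 𝓧).IsLocalization (Db₀ 𝓧).trW :=
    Functor.IsLocalization.of_iso _ (DbThetaTildeFac 𝓧).symm
  exact isEquivalence_of_isLocalization_comp (VerdierQuotient.Q (Db₀ 𝓧)) (Db₀ 𝓧).trW _

end Equivalences

end RelativeAuslander

theorem proposition3p3 (R : Type v) [CommRing R] [IsArtinianRing R]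
    (Λ : Type u) [Ring Λ] [Algebra R Λ] [Module.Finite R Λ]
    (𝓧 : ObjectProperty (FGModuleCat.{u} Λᵐᵒᵖ))
    [RelativeAuslander.ContravariantlyFinite 𝓧] [RelativeAuslander.ContainsProjectives 𝓧] :
    haveI : IsNoetherianRing Λᵐᵒᵖ := RelativeAuslander.isNoetherianRing_mulOpposite R Λ
    ((RelativeAuslander.thetaTilde 𝓧).IsTriangulated ∧
      (RelativeAuslander.thetaTilde 𝓧).IsEquivalence) ∧
    ((RelativeAuslander.DbThetaTilde 𝓧).IsTriangulated ∧
      (RelativeAuslander.DbThetaTilde 𝓧).IsEquivalence) := by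
  have : IsNoetherianRing Λᵐᵒᵖ := RelativeAuslander.isNoetherianRing_mulOpposite R Λ
  exact ⟨⟨inferInstance, inferInstance⟩, ⟨inferInstance, inferInstance⟩⟩
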